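/- Let $\mathbb X,\mathbb Y$ be finite-dimensional real Hilbert spaces and let $B(x,r)$ denote the closed ball with center $x$ and radius $r$. Definitions. For a nonempty closed convex set $C$, $\sigma_C(x)=\sup_{y\in C}\langle x,y\rangle$ is its support function, and $\mathcal N_C(x)=\{u:\langle u,z-x\rangle\le 0\ \forall z\in C\}$ for $x\in C$, $\mathcal N_C(x)=\emptyset$ for $x\notin C$, is its normal cone. Let $\alpha\in(0,1]$. A closed set $\mathfrak D\subseteq\mathbb X$ is $C^{1,\alpha}$-cone reducible if for every $\hat x\in\mathfrak D$ there are $\rho>0$, a finite-dimensional real Hilbert space $\mathbb W$, a closed convex cone $K\subseteq\mathbb W$ with $K\cap(-K)=\{0\}$, and a map $\Xi:\mathbb X\to\mathbb W$ with $\Xi(\hat x)=0$ that is continuously differentiable in $B(\hat x,\rho)$, such that $D\Xi(\hat x)$ is surjective, $x\mapsto D\Xi(x)$ is $\alpha$-Hölder continuous in $B(\hat x,\rho)$, and $\mathfrak D\cap B(\hat x,\rho)=\{x:\Xi(x)\in K\}\cap B(\hat x,\rho)$. A pair of closed convex sets $\{\mathfrak D_1,\mathfrak D_2\}$ is boundedly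 linearly regular at $\hat x\in\mathfrak D_1\cap\mathfrak D_2$ if for every bounded neighborhood $U$ of $\hat x$ there is $c>0$ with $\operatorname{dist}(x,\mathfrak D_1\cap\mathfrak D_2)\le c\,(\operatorname{dist}(x,\mathfrak D_1)+\operatorname{dist}(x,\mathfrak D_2))$ for all $x\in U$. A proper closed convex function $h:\mathbb X\to(-\infty,\infty]$ satisfies the KL property with exponent $\theta\in[0,1)$ at a point $\hat x$ with $\partial h(\hat x)\ne\emptyset$ if there are $c\in(0,\infty]$, $\alpha_0>0$ and a neighborhood $U$ of $\hat x$ such that, with $\varphi(s)=\alpha_0 s^{1-\theta}$, one has $\varphi'(h(x)-h(\hat x))\operatorname{dist}(0,\partial h(x))\ge 1$ for all $x\in U$ with $h(\hat x)<h(x)<h(\hat x)+c$ (where $\operatorname{dist}(0,\emptyset)=+\infty$, and $\partial h$ is the subdifferential of convex analysis). Theorem. Let $\alpha\in(0,1]$, let $\mathfrak D\subseteq\mathbb X$ be a nonempty closed convex $C^{1,\alpha}$-cone reducible set, let $\mathcal T:\mathbb X\to\mathbb Y$ be linear with adjoint $\mathcal T^*$, let $l:\mathbb Y\to\mathbb R$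 be differentiable with locally Lipschitz gradient and strongly convex on every compact convex set (with a modulus that may depend on the set), and let $v\in\mathbb X$. Put $$h(x)=l(\mathcal Tx)+\langle v,x\rangle+\sigma_{\mathfrak D}(x).$$ Then for every $\bar x\in\operatorname{Arg\,min}h$, with $\bar w:=-\mathcal T^*\nabla l(\mathcal T\bar x)-v$: 1. $\bar x\in\mathcal N_{\mathfrak D}(\bar w)$. 2. There exist $\rho,\delta,\kappa>0$ such that $$\mathcal N_{\mathfrak D}(w)\cap B(\bar x,\delta)\subseteq\mathcal N_{\mathfrak D}(\bar w)+\kappa\|w-\bar w\|^{\alpha}B(0,1)\qquad\text{for all }w\in B(\bar w,\rho).$$ 3. If $\{\mathcal T^{-1}\{\mathcal T\bar x\},\ \mathcal N_{\mathfrak D}(\bar w)\}$ is boundedly linearly regular at $\bar x$, then $h$ satisfies the KL property at $\bar x$ with exponent $\frac1{\alpha+1}$. -/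

import Mathlib

open Set Metric Topology
open scoped NNReal ENNReal Pointwise Gradient RealInnerProductSpace

noncomputable section

namespace ConvexKL

section Basic

variable {E : Type*} [NormedAddCommGroup E] [InnerProductSpace ℝ E]

/-- The support function `σ_C(x) = sup {⟪x, y⟫ : y ∈ C}`, with values in the extended reals. -/
def supportFunction (C : Set E) (x : E) : EReal :=
  ⨆ y ∈ C, ((⟪x, y⟫ : ℝ) : EReal)

/-- The normal cone of `C` at `x`, i.e. the subdifferential at `x` of the indicator function
of `C`. In particular it is empty when `x ∉ C`. -/
def normalCone (C : Set E) (x : E) : Set E :=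
  {v | x ∈ C ∧ ∀ u ∈ C, ⟪v, u - x⟫ ≤ 0}

/-- The convex subdifferential of an extended-real-valued function. -/
def subdifferential (h : E → EReal) (x : E) : Set E :=
  {ξ | ∀ y, h x + ((⟪ξ, y - x⟫ : ℝ) : EReal) ≤ h y}

/-- `h : E → (-∞, ∞]` is proper (finite somewhere), closed (lower semicontinuous) and convex
(its epigraph is convex). -/
def IsProperClosedConvex (h : E → EReal) : Prop :=
  (∀ x, h x ≠ ⊥) ∧ (∃ x, h x ≠ ⊤) ∧ LowerSemicontinuous h ∧
    Convex ℝ {p : E × ℝ | h p.1 ≤ (p.2 : EReal)}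

/-- The Kurdyka-Lojasiewicz property of a proper closed convex function `h : E → (-∞, ∞]` at `x₀`
with desingularizing function `φ : [0, c) → [0, ∞)` (only the values of `φ` on `[0, c)` matter).
The distance from `0` to the subdifferential is taken in `[0, ∞]`, so that it is `∞` when the
subdifferential is empty. -/
def HasKLPropertyWith (h : E → EReal) (x₀ : E) (c : EReal) (φ : ℝ → ℝ) : Prop :=
  IsProperClosedConvex h ∧
  (subdifferential h x₀).Nonempty ∧
  0 < c ∧
  ContinuousOn φ {s : ℝ | 0 ≤ s ∧ (s : EReal) < c} ∧
  ConcaveOn ℝ {s : ℝ | 0 ≤ s ∧ (s : EReal) < c} φ ∧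
  (∀ s : ℝ, 0 ≤ s → (s : EReal) < c → 0 ≤ φ s) ∧
  φ 0 = 0 ∧
  ContDiffOn ℝ 1 φ {s : ℝ | 0 < s ∧ (s : EReal) < c} ∧
  (∀ s : ℝ, 0 < s → (s : EReal) < c → 0 < deriv φ s) ∧
  ∃ U ∈ 𝓝 x₀, ∀ x ∈ U, h x₀ < h x → h x < h x₀ + c →
    1 ≤ ENNReal.ofReal (deriv φ (h x - h x₀).toReal) * infEDist 0 (subdifferential h x)

/-- The KL property at `x₀` with exponent `θ ∈ [0, 1)`: the KL property with a desingularizing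
function of the form `s ↦ a * s ^ (1 - θ)`, `a > 0`. -/
def HasKLExponentAt (h : E → EReal) (x₀ : E) (θ : ℝ) : Prop :=
  0 ≤ θ ∧ θ < 1 ∧ ∃ c : EReal, ∃ a : ℝ, 0 < a ∧
    HasKLPropertyWith h x₀ c (fun s => a * s ^ (1 - θ))

/-- `C` is `C^{1,α}`-cone reducible at `x₀`. Every finite-dimensional real Hilbert space is
isometric to some `EuclideanSpace ℝ (Fin k)`, so it suffices to let the reduced cone `K` range over
the latter spaces. A `ProperCone` is a closed convex cone containing the origin; pointedness of `K`
means that `K` contains no line. -/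
def IsConeReducibleAt (α : ℝ≥0) (C : Set E) (x₀ : E) : Prop :=
  ∃ ρ : ℝ, 0 < ρ ∧ ∃ (k : ℕ) (K : ProperCone ℝ (EuclideanSpace ℝ (Fin k)))
      (Ξ : E → EuclideanSpace ℝ (Fin k)),
    (∀ z ∈ K, -z ∈ K → z = 0) ∧
    Ξ x₀ = 0 ∧
    (∀ x ∈ closedBall x₀ ρ, DifferentiableAt ℝ Ξ x) ∧
    ContinuousOn (fderiv ℝ Ξ) (closedBall x₀ ρ) ∧
    Function.Surjective (fderiv ℝ Ξ x₀) ∧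
    (∃ L : ℝ≥0, HolderOnWith L α (fderiv ℝ Ξ) (closedBall x₀ ρ)) ∧
    C ∩ closedBall x₀ ρ = {x | Ξ x ∈ K} ∩ closedBall x₀ ρ

/-- A `C^{1,α}`-cone reducible set: closed, and cone reducible at each of its points. -/
def IsConeReducible (α : ℝ≥0) (C : Set E) : Prop :=
  IsClosed C ∧ ∀ x ∈ C, IsConeReducibleAt α C x

/-- Bounded linear regularity of the pair `{C₁, C₂}` at a common point `x₀`. -/
def BoundedlyLinearlyRegularAt (C₁ C₂ : Set E) (x₀ : E) : Prop :=
  x₀ ∈ C₁ ∩ C₂ ∧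
  ∀ U ∈ 𝓝 x₀, Bornology.IsBounded U → ∃ c : ℝ, 0 < c ∧
    ∀ x ∈ U, infDist x (C₁ ∩ C₂) ≤ c * (infDist x C₁ + infDist x C₂)

/-- `l` is strongly convex on every compact convex set (the modulus may depend on the set). -/
def LocallyStronglyConvex (l : E → ℝ) : Prop :=
  ∀ S : Set E, IsCompact S → Convex ℝ S → ∃ m : ℝ, 0 < m ∧ StrongConvexOn S m l

end Basic

section Objective

variable {X Y : Type*} [NormedAddCommGroup X] [InnerProductSpace ℝ X]
  [NormedAddCommGroup Y] [InnerProductSpace ℝ Y]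

/-- The function `h(x) = l(Tx) + ⟪v, x⟫ + σ_D(x)`. -/
def objective (l : Y → ℝ) (T : X →ₗ[ℝ] Y) (v : X) (D : Set X) (x : X) : EReal :=
  ((l (T x) + ⟪v, x⟫ : ℝ) : EReal) + supportFunction D x

end Objective

end ConvexKL

end

/-! Write `N` for the normal cone of `D` at `w = -T* ∇l(T x₀) - v`. The gap `s = h(x) - h(x₀)`
splits into the Bregman distance of `l` between `T x` and `T x₀` plus `σ_D(x) - ⟪x, w⟫`, both
nonnegative. Strong convexity bounds the first below by a multiple of `‖T x - T x₀‖²`. For the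
second, the reduction map shows that `D` follows each unit direction of the polar of `N` up to an
error `O(t^(1+α))`. Choosing the direction from `x`'s projection onto `N` to `x` gives `s ≥ t *
dist(x, N) - C * t^(1+α)` for small `t`, hence `dist(x, N) = O(s^(α/(1+α)))`. Bounded linear
regularity merges the two bounds into an error bound for the fibre intersected with `N`. There `h`
equals its minimum, so a subgradient inequality turns the error bound into KL
(`objective_hasKLExponentAt`).

The Hölder estimate is separate: a normal at a nearby point is `DΞ(·)* μ` with `μ` polar to `K` and
bounded; moving the derivative to the reference point while keeping `μ` costs `‖μ‖` times its Hölder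
variation (`IsConeReducibleAt.exists_normalCone_near`). -/

namespace ConvexKL

/-! ### Metric regularity -/

section MetricRegularity

variable {E F : Type*} [NormedAddCommGroup E] [NormedSpace ℝ E] [CompleteSpace E]
  [NormedAddCommGroup F] [NormedSpace ℝ F] [CompleteSpace F]

/-- Metric regularity of a map with surjective strict derivative. -/
theorem exists_preimage_norm_sub_le {f : E → F} {f' : E →L[ℝ] F} {a : E}
    (hf : HasStrictFDerivAt f f' a) (hs : Function.Surjective f') :
    ∃ M > (0 : ℝ), ∃ ε > (0 : ℝ), ∀ b ∈ closedBall a ε, ∀ z, ‖z - f b‖ ≤ ε →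
      ∃ y, f y = z ∧ ‖y - b‖ ≤ M * ‖z - f b‖ := by
  have hr : f'.range = ⊤ := LinearMap.range_eq_top.2 hs
  set g := f'.nonlinearRightInverseOfSurjective hr
  have hN : 0 < g.nnnorm := f'.nonlinearRightInverseOfSurjective_nnnorm_pos hr
  -- With half of the critical constant, the ball of radius `2 * g.nnnorm * ‖z - f b‖` covers
  -- exactly the radius `‖z - f b‖` in the target.
  obtain ⟨s, hsn, hA⟩ := hf.approximates_deriv_on_nhds (c := g.nnnorm⁻¹ / 2)
    (Or.inr (by positivity))
  obtain ⟨r, hr0, hrs⟩ := Metric.nhds_basis_closedBall.mem_iff.1 hsn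
  have hN' : (0 : ℝ) < g.nnnorm := hN
  refine ⟨2 * g.nnnorm, by positivity, min (r / 2) (r / (4 * g.nnnorm)), by positivity, ?_⟩
  intro b hb z hz
  have hz2 : 2 * g.nnnorm * ‖z - f b‖ ≤ r / 2 := by
    have := hz.trans (min_le_right _ _)
    rw [le_div_iff₀ (by positivity)] at this
    linarith
  have hsub : closedBall b (2 * g.nnnorm * ‖z - f b‖) ⊆ s := by
    refine (closedBall_subset_closedBall' ?_).trans hrs
    have := (mem_closedBall.1 hb).trans (min_le_left _ _)
    linarith
  have := hA.surjOn_closedBall_of_nonlinearRightInverse g (by positivity) hsub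
  obtain ⟨y, hy, hyz⟩ := this (show z ∈ _ by
    rw [mem_closedBall, dist_eq_norm]
    push_cast
    apply le_of_eq
    field_simp
    norm_num)
  exact ⟨y, hyz, by simpa [dist_eq_norm] using hy⟩

end MetricRegularity

/-! ### Normals and the polar of a linear preimage -/

section NormalCone

variable {X W : Type*} [NormedAddCommGroup X] [InnerProductSpace ℝ X] [FiniteDimensional ℝ X]
  [NormedAddCommGroup W] [InnerProductSpace ℝ W] [FiniteDimensional ℝ W]

/-- The polar cone of the preimage of `K` under a surjective linear map. -/
theorem exists_inner_eq_of_polar_preimage {A : X →L[ℝ] W} (hA : Function.Surjective A)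
    {K : ProperCone ℝ W} {x : X} (hx : ∀ d, A d ∈ K → ⟪x, d⟫ ≤ 0) :
    ∃ μ : W, (∀ z ∈ K, ⟪μ, z⟫ ≤ 0) ∧ ∀ d, ⟪x, d⟫ = ⟪μ, A d⟫ := by
  obtain ⟨R, hR⟩ := (A : X →ₗ[ℝ] W).exists_rightInverse_of_surjective
    (LinearMap.range_eq_top.2 hA)
  have hAR : ∀ z, A (R z) = z := fun z => LinearMap.congr_fun hR z
  have hμ : ∀ z, ⟪LinearMap.adjoint R x, z⟫ = ⟪x, R z⟫ := fun z => LinearMap.adjoint_inner_left R z x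
  refine ⟨LinearMap.adjoint R x, fun z hz => ?_, fun d => ?_⟩
  · rw [hμ]
    exact hx _ (by rwa [hAR])
  · rw [hμ]
    -- This vector and its negative lie in the kernel of `A`, so `x` is orthogonal to it.
    have h1 := hx (d - R (A d)) (by simp [hAR])
    have h2 := hx (-(d - R (A d))) (by simp [hAR])
    rw [inner_neg_right] at h2
    rw [inner_sub_right] at h1 h2
    linarith

/-- Normals are nonpositive on the preimage of the cone under the derivative of a reduction map. -/
theorem inner_nonpos_of_mem_normalCone {D : Set X} {K : ProperCone ℝ W} {Ξ : X → W}
    {A : X →L[ℝ] W} {w : X} (hΞ : HasStrictFDerivAt Ξ A w) (hA : Function.Surjective A)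
    (hD : ∀ᶠ y in 𝓝 w, Ξ y ∈ K → y ∈ D) (hw : Ξ w ∈ K) {x : X} (hx : x ∈ normalCone D w)
    {d : X} (hd : A d ∈ K) : ⟪x, d⟫ ≤ 0 := by
  have := FiniteDimensional.complete ℝ X
  have := FiniteDimensional.complete ℝ W
  obtain ⟨M, hM, ε, hε, hreg⟩ := exists_preimage_norm_sub_le hΞ hA
  obtain ⟨r, hr, hrD⟩ := Metric.eventually_nhds_iff_ball.1 hD
  refine le_of_forall_pos_le_add fun η hη => ?_
  rw [zero_add]
  obtain ⟨c, hc, hcη⟩ : ∃ c > 0, ‖x‖ * (M * (c * ‖d‖)) ≤ η := by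
    refine ⟨η / (‖x‖ * M * ‖d‖ + 1), by positivity, ?_⟩
    have : ‖x‖ * (M * (η / (‖x‖ * M * ‖d‖ + 1) * ‖d‖))
      = η * ((‖x‖ * M * ‖d‖) / (‖x‖ * M * ‖d‖ + 1)) := by ring
    rw [this]
    refine mul_le_of_le_one_right hη.le ((div_le_one (by positivity)).2 (by linarith))
  have hlim : Filter.Tendsto (fun t : ℝ => t • d) (𝓝[>] 0) (𝓝 0) := by
    have : Filter.Tendsto (fun t : ℝ => t • d) (𝓝 0) (𝓝 ((0 : ℝ) • d)) :=
      (continuous_id.smul continuous_const).tendsto 0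
    rw [zero_smul] at this
    exact this.mono_left nhdsWithin_le_nhds
  have h1 := hlim.eventually
    ((hasFDerivAt_iff_isLittleO_nhds_zero.1 hΞ.hasFDerivAt).def hc)
  have h2 : ∀ᶠ t : ℝ in 𝓝[>] 0, ‖t • d‖ < ε :=
    hlim.norm.eventually (by rw [norm_zero]; exact eventually_lt_nhds hε)
  have h3 : ∀ᶠ t : ℝ in 𝓝[>] 0, c * ‖t • d‖ < ε :=
    (hlim.norm.const_mul c).eventually (by rw [norm_zero, mul_zero]; exact eventually_lt_nhds hε)
  have h4 : ∀ᶠ t : ℝ in 𝓝[>] 0, ‖t • d‖ + M * (c * ‖t • d‖) < r :=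
    (hlim.norm.add ((hlim.norm.const_mul c).const_mul M)).eventually
      (by rw [norm_zero, mul_zero, mul_zero, add_zero]; exact eventually_lt_nhds hr)
  obtain ⟨t, h1, h2, h3, h4, ht⟩ :=
    (h1.and (h2.and (h3.and (h4.and self_mem_nhdsWithin)))).exists
  have ht : 0 < t := ht
  have hz : ‖(Ξ w + t • A d) - Ξ (w + t • d)‖ ≤ c * ‖t • d‖ := by
    have : Ξ w + t • A d - Ξ (w + t • d) = -(Ξ (w + t • d) - Ξ w - A (t • d)) := by
      rw [map_smul]
      abel
    rwa [this, norm_neg]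
  -- Metric regularity corrects `w + t • d` to a point of `D`. The correction is at most `M * c * ‖t
  -- • d‖`, and `c` was chosen so that it contributes at most `t * η`.
  obtain ⟨y, hy, hyb⟩ := hreg (w + t • d) (by simpa [dist_eq_norm] using h2.le)
    (Ξ w + t • A d) (hz.trans h3.le)
  have hyb' : ‖y - (w + t • d)‖ ≤ M * (c * ‖t • d‖) :=
    hyb.trans (mul_le_mul_of_nonneg_left hz hM.le)
  have hyK : Ξ y ∈ K := by
    rw [hy]
    exact K.add_mem hw (K.smul_mem hd ht.le)
  have hyD : y ∈ D := by
    refine hrD y ?_ hyK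
    rw [mem_ball, dist_eq_norm]
    calc ‖y - w‖ = ‖t • d + (y - (w + t • d))‖ := by congr 1; abel
      _ ≤ ‖t • d‖ + ‖y - (w + t • d)‖ := norm_add_le _ _
      _ < r := by linarith
  have h5 := hx.2 y hyD
  have h6 : y - w = t • d + (y - (w + t • d)) := by abel
  rw [h6, inner_add_right, inner_smul_right] at h5
  have h7 : -⟪x, y - (w + t • d)⟫ ≤ ‖x‖ * ‖y - (w + t • d)‖ :=
    (neg_le_abs _).trans (abs_real_inner_le_norm _ _)
  have h8 : ‖x‖ * ‖y - (w + t • d)‖ ≤ ‖x‖ * (M * (c * ‖t • d‖)) := by gcongr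
  rw [norm_smul, Real.norm_of_nonneg ht.le] at h8
  have h9 : t * ⟪x, d⟫ ≤ t * (‖x‖ * (M * (c * ‖d‖))) := by linarith
  exact (le_of_mul_le_mul_left h9 ht).trans hcη

end NormalCone

/-! ### Feasible directions -/

section Reduction

variable {X W : Type*} [NormedAddCommGroup X] [InnerProductSpace ℝ X]
  [NormedAddCommGroup W] [InnerProductSpace ℝ W]

/-- The derivative of the reduction map sends feasible directions into the cone. -/
theorem fderiv_mem_of_reduction {D : Set X} (hDconv : Convex ℝ D) {K : ProperCone ℝ W} {Ξ : X → W}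
    {A : X →L[ℝ] W} {w : X} (hΞ : HasFDerivAt Ξ A w) (hw : w ∈ D) (hw0 : Ξ w = 0)
    (hD : ∀ᶠ y in 𝓝 w, y ∈ D → Ξ y ∈ K) {u : X} (hu : u ∈ D) : A (u - w) ∈ K := by
  have hline : HasDerivAt (fun t : ℝ => Ξ (w + t • (u - w))) (A (u - w)) 0 := by
    have hl : HasDerivAt (fun t : ℝ => w + t • (u - w)) (u - w) 0 := by
      simpa using ((hasDerivAt_id (0 : ℝ)).smul_const (u - w)).const_add w
    have hΞ' : HasFDerivAt Ξ A (w + (0 : ℝ) • (u - w)) := by simpa using hΞ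
    exact hΞ'.comp_hasDerivAt (0 : ℝ) hl
  have hs := (hasDerivAt_iff_tendsto_slope_zero.1 hline).mono_left
    (nhdsGT_le_nhdsNE (0 : ℝ))
  have hlim : Filter.Tendsto (fun t : ℝ => w + t • (u - w)) (𝓝[>] 0) (𝓝 w) := by
    have : Filter.Tendsto (fun t : ℝ => w + t • (u - w)) (𝓝 0) (𝓝 (w + (0 : ℝ) • (u - w))) :=
      (by fun_prop : Continuous fun t : ℝ => w + t • (u - w)).tendsto 0
    rw [zero_smul, add_zero] at this
    exact this.mono_left nhdsWithin_le_nhds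
  -- Since `Ξ w = 0`, the difference quotients along the segment are themselves in the cone.
  refine K.isClosed.mem_of_tendsto hs ?_
  filter_upwards [hlim.eventually hD, self_mem_nhdsWithin,
    nhdsWithin_le_nhds (eventually_lt_nhds (zero_lt_one (α := ℝ)))] with t h1 (h2 : 0 < t) h3
  simp only [zero_add, zero_smul, add_zero, hw0, sub_zero]
  refine K.smul_mem (h1 ?_) (inv_nonneg.2 h2.le)
  have := hDconv hw hu (sub_nonneg.2 h3.le) h2.le (by ring)
  convert this using 1
  module

end Reduction

/-! ### Consequences of cone reducibility -/

section ConeReducible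

variable {X : Type*} [NormedAddCommGroup X] [InnerProductSpace ℝ X]

theorem normalCone_convex (D : Set X) (w : X) : Convex ℝ (normalCone D w) := by
  intro x hx y hy a b ha hb _
  refine ⟨hx.1, fun u hu => ?_⟩
  rw [inner_add_left, real_inner_smul_left, real_inner_smul_left]
  exact add_nonpos (mul_nonpos_of_nonneg_of_nonpos ha (hx.2 u hu))
    (mul_nonpos_of_nonneg_of_nonpos hb (hy.2 u hu))

theorem normalCone_add_mem {D : Set X} {w x y : X} (hx : x ∈ normalCone D w)
    (hy : y ∈ normalCone D w) : x + y ∈ normalCone D w := by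
  refine ⟨hx.1, fun u hu => ?_⟩
  rw [inner_add_left]
  exact add_nonpos (hx.2 u hu) (hy.2 u hu)

theorem normalCone_isClosed (D : Set X) (w : X) : IsClosed (normalCone D w) := by
  have : normalCone D w = {_v | w ∈ D} ∩ ⋂ u ∈ D, {v | ⟪v, u - w⟫ ≤ 0} := by
    ext v
    simp [normalCone]
  rw [this]
  refine isClosed_const.inter (isClosed_biInter fun u _ => ?_)
  exact isClosed_le (by fun_prop) continuous_const

theorem zero_mem_normalCone {D : Set X} {w : X} (hw : w ∈ D) : (0 : X) ∈ normalCone D w :=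
  ⟨hw, fun u _ => by simp⟩

variable [FiniteDimensional ℝ X]

/-- Near the reference point, normal vectors of bounded size are `α`-Hölder close to the normal
cone at the reference point. -/
theorem IsConeReducibleAt.exists_normalCone_near {α : ℝ≥0} {D : Set X} {x₀ : X}
    (hred : IsConeReducibleAt α D x₀) (hDconv : Convex ℝ D) (hx₀ : x₀ ∈ D) (B : ℝ) (hB : 0 < B) :
    ∃ ρ > (0 : ℝ), ∃ κ > (0 : ℝ), ∀ w ∈ closedBall x₀ ρ, ∀ x ∈ normalCone D w, ‖x‖ ≤ B →
      ∃ x' ∈ normalCone D x₀, ‖x - x'‖ ≤ κ * ‖w - x₀‖ ^ (α : ℝ) := by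
  have := FiniteDimensional.complete ℝ X
  obtain ⟨ρ, hρ, k, K, Ξ, -, hΞ0, hdiff, hcont, hsurj, ⟨L, hL⟩, hDK⟩ := hred
  set A := fderiv ℝ Ξ with hAdef
  have hmem : ∀ y ∈ closedBall x₀ ρ, (y ∈ D ↔ Ξ y ∈ K) := fun y hy => by
    simpa [hy] using congrArg (y ∈ ·) hDK
  have hx₀ball : ball x₀ ρ ∈ 𝓝 x₀ := ball_mem_nhds _ hρ
  obtain ⟨R, hR⟩ := (A x₀ : X →ₗ[ℝ] EuclideanSpace ℝ (Fin k)).exists_rightInverse_of_surjective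
    (LinearMap.range_eq_top.2 hsurj)
  have hAR : ∀ z, A x₀ (R z) = z := fun z => LinearMap.congr_fun hR z
  obtain ⟨c, hc, hRc⟩ := (LinearMap.toContinuousLinearMap R).bound
  simp only [LinearMap.coe_toContinuousLinearMap'] at hRc
  have hAcont : ContinuousAt A x₀ := hcont.continuousAt (closedBall_mem_nhds _ hρ)
  have hnear : ∀ᶠ w in 𝓝 x₀, ‖A w - A x₀‖ < 1 / (2 * c) := by
    have := hAcont.eventually (ball_mem_nhds (A x₀) (show (0 : ℝ) < 1 / (2 * c) by positivity))
    simpa [dist_eq_norm] using this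
  obtain ⟨r, hr, hrA⟩ := Metric.nhds_basis_closedBall.eventually_iff.1 (hnear.and hx₀ball)
  refine ⟨r, hr, L * (2 * c * B) + 1, by positivity, fun w hw x hx hxB => ?_⟩
  obtain ⟨hwA, hwρ⟩ := hrA hw
  have hdiffR : ∀ z, ‖(A w - A x₀) (R z)‖ ≤ 1 / 2 * ‖z‖ := fun z => by
    calc ‖(A w - A x₀) (R z)‖ ≤ ‖A w - A x₀‖ * ‖R z‖ := (A w - A x₀).le_opNorm _
      _ ≤ 1 / (2 * c) * (c * ‖z‖) := by gcongr; exact hRc z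
      _ = 1 / 2 * ‖z‖ := by field_simp
  -- `A w ∘ R` differs from the identity by at most `1/2` in norm, so it is injective, hence
  -- bijective in finite dimension.
  have hsurjw : Function.Surjective (A w) := by
    have hinj : Function.Injective ((A w : X →ₗ[ℝ] EuclideanSpace ℝ (Fin k)) ∘ₗ R) := by
      rw [injective_iff_map_eq_zero]
      intro z hz
      have h1 := hdiffR z
      have hz : A w (R z) = 0 := hz
      rw [_root_.sub_apply, hz, hAR, zero_sub, norm_neg] at h1
      exact norm_le_zero_iff.1 (by linarith [norm_nonneg z])
    intro z
    obtain ⟨y, hy⟩ := LinearMap.injective_iff_surjective.1 hinj z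
    exact ⟨R y, hy⟩
  have hwnhds : closedBall x₀ ρ ∈ 𝓝 w :=
    Filter.mem_of_superset (isOpen_ball.mem_nhds hwρ) ball_subset_closedBall
  have hstrict : HasStrictFDerivAt Ξ (A w) w :=
    hasStrictFDerivAt_of_hasFDerivAt_of_continuousAt
      (Filter.mem_of_superset hwnhds fun y hy => (hdiff y hy).hasFDerivAt)
      (hcont.continuousAt hwnhds)
  obtain ⟨μ, hμK, hμ⟩ := exists_inner_eq_of_polar_preimage hsurjw (K := K) (x := x) fun d hd =>
    inner_nonpos_of_mem_normalCone hstrict hsurjw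
      (Filter.mem_of_superset hwnhds fun y hy => (hmem y hy).2)
      ((hmem w (ball_subset_closedBall hwρ)).1 hx.1) hx hd
  -- Testing `μ` on `A x₀ (R μ) = μ` leaves an error of at most `‖μ‖² / 2`, which is absorbed on the
  -- left.
  have hμB : ‖μ‖ ≤ 2 * c * B := by
    have h1 : ‖μ‖ ^ 2 ≤ B * (c * ‖μ‖) + ‖μ‖ * (1 / 2 * ‖μ‖) := by
      calc ‖μ‖ ^ 2 = ⟪μ, A x₀ (R μ)⟫ := by rw [hAR, real_inner_self_eq_norm_sq]
        _ = ⟪x, R μ⟫ - ⟪μ, (A w - A x₀) (R μ)⟫ := by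
          rw [hμ, _root_.sub_apply, inner_sub_right]; ring
        _ ≤ ‖x‖ * ‖R μ‖ + ‖μ‖ * ‖(A w - A x₀) (R μ)‖ := by
          have := real_inner_le_norm x (R μ)
          have := (neg_le_abs _).trans (abs_real_inner_le_norm μ ((A w - A x₀) (R μ)))
          linarith
        _ ≤ _ := by
          gcongr
          · exact hRc μ
          · exact hdiffR μ
    rcases (norm_nonneg μ).eq_or_lt with h0 | h0
    · rw [← h0]; positivity
    · refine le_of_mul_le_mul_right ?_ h0
      nlinarith
  set x' := LinearMap.adjoint (A x₀ : X →ₗ[ℝ] EuclideanSpace ℝ (Fin k)) μ with hx'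
  have hx'd : ∀ d, ⟪x', d⟫ = ⟪μ, A x₀ d⟫ := fun d => LinearMap.adjoint_inner_left _ _ _
  refine ⟨x', ⟨hx₀, fun u hu => ?_⟩, ?_⟩
  · rw [hx'd]
    exact hμK _ (fderiv_mem_of_reduction hDconv (hdiff x₀ (mem_closedBall_self hρ.le)).hasFDerivAt
      hx₀ hΞ0 (Filter.mem_of_superset (closedBall_mem_nhds _ hρ) fun y hy => (hmem y hy).1) hu)
  · have hHol : ‖A w - A x₀‖ ≤ L * ‖w - x₀‖ ^ (α : ℝ) := by
      have := hL.dist_le (ball_subset_closedBall hwρ) (mem_closedBall_self hρ.le)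
      rwa [dist_eq_norm, dist_eq_norm] at this
    have h1 : ‖x - x'‖ * ‖x - x'‖ ≤ (2 * c * B * (L * ‖w - x₀‖ ^ (α : ℝ))) * ‖x - x'‖ := by
      calc ‖x - x'‖ * ‖x - x'‖ = ⟪x - x', x - x'⟫ := (real_inner_self_eq_norm_mul_norm _).symm
        _ = ⟪μ, (A w - A x₀) (x - x')⟫ := by
          rw [inner_sub_left, hμ, hx'd, _root_.sub_apply, inner_sub_right]
        _ ≤ ‖μ‖ * ‖(A w - A x₀) (x - x')‖ := real_inner_le_norm _ _
        _ ≤ ‖μ‖ * (‖A w - A x₀‖ * ‖x - x'‖) := by gcongr; exact (A w - A x₀).le_opNorm _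
        _ ≤ 2 * c * B * ((L * ‖w - x₀‖ ^ (α : ℝ)) * ‖x - x'‖) := by gcongr
        _ = _ := by ring
    have hpow : 0 ≤ ‖w - x₀‖ ^ (α : ℝ) := by positivity
    rcases (norm_nonneg (x - x')).eq_or_lt with h0 | h0
    · rw [← h0]; positivity
    · have := le_of_mul_le_mul_right h1 h0
      linarith

/-- A cone reducible convex set contains, along each direction of the tangent cone, a curve of
order `1 + α`. -/
theorem IsConeReducibleAt.exists_tangent_curve {α : ℝ≥0} {D : Set X} {x₀ : X}
    (hred : IsConeReducibleAt α D x₀) (hDconv : Convex ℝ D) (hx₀ : x₀ ∈ D) :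
    ∃ t₀ > (0 : ℝ), ∃ C > (0 : ℝ), ∀ e : X, ‖e‖ ≤ 1 → (∀ x ∈ normalCone D x₀, ⟪x, e⟫ ≤ 0) →
      ∀ t ∈ Icc 0 t₀, ∃ w ∈ D, ‖w - (x₀ + t • e)‖ ≤ C * t ^ (1 + (α : ℝ)) := by
  have := FiniteDimensional.complete ℝ X
  obtain ⟨ρ, hρ, k, K, Ξ, -, hΞ0, hdiff, hcont, hsurj, ⟨L, hL⟩, hDK⟩ := hred
  set A := fderiv ℝ Ξ with hAdef
  have hmem : ∀ y ∈ closedBall x₀ ρ, (y ∈ D ↔ Ξ y ∈ K) := fun y hy => by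
    simpa [hy] using congrArg (y ∈ ·) hDK
  have hnhds : closedBall x₀ ρ ∈ 𝓝 x₀ := closedBall_mem_nhds _ hρ
  have hstrict : HasStrictFDerivAt Ξ (A x₀) x₀ :=
    hasStrictFDerivAt_of_hasFDerivAt_of_continuousAt
      (Filter.mem_of_superset hnhds fun y hy => (hdiff y hy).hasFDerivAt)
      (hcont.continuousAt hnhds)
  obtain ⟨M, hM, ε, hε, hreg⟩ := exists_preimage_norm_sub_le hstrict hsurj
  have hα1 : 0 < 1 + (α : ℝ) := by positivity
  have hlim : Filter.Tendsto (fun t : ℝ => t ^ (1 + (α : ℝ))) (𝓝 0) (𝓝 0) := by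
    have := (Real.continuousAt_rpow_const (0 : ℝ) (1 + (α : ℝ)) (Or.inr hα1.le)).tendsto
    rwa [Real.zero_rpow hα1.ne'] at this
  have hev : ∀ᶠ t : ℝ in 𝓝 0, t < ε ∧ t < ρ ∧ L * t ^ (1 + (α : ℝ)) < ε ∧
      t + M * (L * t ^ (1 + (α : ℝ))) < ρ := by
    refine (eventually_lt_nhds hε).and ((eventually_lt_nhds hρ).and (.and ?_ ?_))
    · exact (hlim.const_mul (L : ℝ)).eventually (by rw [mul_zero]; exact eventually_lt_nhds hε)
    · exact (Filter.tendsto_id.add ((hlim.const_mul (L : ℝ)).const_mul M)).eventually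
        (by rw [mul_zero, mul_zero, add_zero]; exact eventually_lt_nhds hρ)
  obtain ⟨t₀, ht₀, ht₀e⟩ := Metric.nhds_basis_closedBall.eventually_iff.1 hev
  refine ⟨t₀, ht₀, M * L + 1, by positivity, fun e he heN t ht => ?_⟩
  obtain ⟨h1, h2, h3, h4⟩ := ht₀e (show t ∈ closedBall 0 t₀ by
    rw [mem_closedBall, dist_zero_right, Real.norm_of_nonneg ht.1]; exact ht.2)
  -- Otherwise a hyperplane separates `A x₀ e` from `K`, and its normal pulls back to a normal of
  -- `D` at `x₀` that violates `heN`.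
  have hAe : A x₀ e ∈ K := by
    by_contra hK
    obtain ⟨y, hy, hyA⟩ := K.hyperplane_separation' hK
    have hN : LinearMap.adjoint (A x₀ : X →ₗ[ℝ] EuclideanSpace ℝ (Fin k)) (-y) ∈ normalCone D x₀ := by
      refine ⟨hx₀, fun u hu => ?_⟩
      rw [LinearMap.adjoint_inner_left, inner_neg_left, real_inner_comm]
      exact neg_nonpos.2 (hy _ (fderiv_mem_of_reduction hDconv
        (hdiff x₀ (mem_closedBall_self hρ.le)).hasFDerivAt hx₀ hΞ0
        (Filter.mem_of_superset hnhds fun y hy => (hmem y hy).1) hu))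
    have h5 := heN _ hN
    rw [LinearMap.adjoint_inner_left, inner_neg_left, real_inner_comm] at h5
    have h6 : ⟪A x₀ e, y⟫ < 0 := hyA
    have h7 : -⟪A x₀ e, y⟫ ≤ 0 := h5
    linarith
  have hte : ‖t • e‖ ≤ t := by
    rw [norm_smul, Real.norm_of_nonneg ht.1]
    exact mul_le_of_le_one_right ht.1 he
  have hpow : 0 ≤ t ^ (1 + (α : ℝ)) := Real.rpow_nonneg ht.1 _
  have hTaylor : ‖t • A x₀ e - Ξ (x₀ + t • e)‖ ≤ L * t ^ (1 + (α : ℝ)) := by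
    have hsub : closedBall x₀ t ⊆ closedBall x₀ ρ := closedBall_subset_closedBall h2.le
    have := (convex_closedBall x₀ t).norm_image_sub_le_of_norm_fderiv_le'
      (f := Ξ) (φ := A x₀) (C := L * t ^ (α : ℝ)) (x := x₀) (y := x₀ + t • e) (𝕜 := ℝ)
      (fun y hy => hdiff y (hsub hy)) (fun y hy => by
        have hd := hL.dist_le (hsub hy) (mem_closedBall_self hρ.le)
        rw [dist_eq_norm] at hd
        refine hd.trans ?_
        gcongr
        exact hy) (mem_closedBall_self ht.1) (by simpa [dist_eq_norm] using hte)
    rw [hΞ0, sub_zero, add_sub_cancel_left, map_smul, norm_sub_rev] at this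
    refine this.trans ?_
    calc L * t ^ (α : ℝ) * ‖t • e‖ ≤ L * t ^ (α : ℝ) * t := by
          have := Real.rpow_nonneg ht.1 (α : ℝ)
          gcongr
      _ = L * t ^ (1 + (α : ℝ)) := by
          rw [Real.rpow_one_add' ht.1 hα1.ne']; ring
  obtain ⟨w, hw, hwn⟩ := hreg (x₀ + t • e) (by simpa [dist_eq_norm] using hte.trans h1.le)
    (t • A x₀ e) (hTaylor.trans h3.le)
  have hwn' : ‖w - (x₀ + t • e)‖ ≤ M * (L * t ^ (1 + (α : ℝ))) :=
    hwn.trans (mul_le_mul_of_nonneg_left hTaylor hM.le)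
  refine ⟨w, (hmem w ?_).2 ?_, hwn'.trans ?_⟩
  · rw [mem_closedBall, dist_eq_norm]
    calc ‖w - x₀‖ = ‖t • e + (w - (x₀ + t • e))‖ := by congr 1; abel
      _ ≤ ‖t • e‖ + ‖w - (x₀ + t • e)‖ := norm_add_le _ _
      _ ≤ ρ := by linarith
  · rw [hw]
    exact K.smul_mem hAe ht.1
  · nlinarith

/-- The support function of a cone reducible convex set grows along the distance to the normal
cone. -/
theorem IsConeReducibleAt.exists_inner_ge {α : ℝ≥0} {D : Set X} {x₀ : X}
    (hred : IsConeReducibleAt α D x₀) (hDconv : Convex ℝ D) (hx₀ : x₀ ∈ D) (B : ℝ) (hB : 0 < B) :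
    ∃ t₀ > (0 : ℝ), ∃ C > (0 : ℝ), ∀ x : X, ‖x‖ ≤ B → ∀ t ∈ Icc 0 t₀, ∃ w ∈ D,
      t * infDist x (normalCone D x₀) - C * t ^ (1 + (α : ℝ)) ≤ ⟪x, w - x₀⟫ := by
  have := FiniteDimensional.complete ℝ X
  obtain ⟨t₀, ht₀, C, hC, hcurve⟩ := hred.exists_tangent_curve hDconv hx₀
  refine ⟨t₀, ht₀, B * C, by positivity, fun x hx t ht => ?_⟩
  have hpow : 0 ≤ t ^ (1 + (α : ℝ)) := Real.rpow_nonneg ht.1 _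
  have hne : (normalCone D x₀).Nonempty := ⟨0, zero_mem_normalCone hx₀⟩
  obtain ⟨p, hp, hpx⟩ := exists_norm_eq_iInf_of_complete_convex hne
    (normalCone_isClosed D x₀).isComplete (normalCone_convex D x₀) x
  have hproj := (norm_eq_iInf_iff_real_inner_le_zero (normalCone_convex D x₀) hp).1 hpx
  have hpol : ∀ y ∈ normalCone D x₀, ⟪y, x - p⟫ ≤ 0 := fun y hy => by
    have := hproj _ (normalCone_add_mem hp hy)
    rwa [add_sub_cancel_left, real_inner_comm] at this
  -- Moreau decomposition: comparing `p` with `2p` and with `0` gives both signs.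
  have horth : ⟪x - p, p⟫ = 0 := by
    have h1 := hproj _ (normalCone_add_mem hp hp)
    have h2 := hproj _ (zero_mem_normalCone hx₀)
    rw [add_sub_cancel_left] at h1
    rw [zero_sub, inner_neg_right] at h2
    linarith
  have hdist : infDist x (normalCone D x₀) ≤ ‖x - p‖ := by
    rw [← dist_eq_norm]
    exact infDist_le_dist_of_mem hp
  set r := ‖x - p‖ with hr
  -- If `r = 0` then `e = 0`, which the bound `‖e‖ ≤ 1` still allows.
  set e := r⁻¹ • (x - p) with he
  have he1 : ‖e‖ ≤ 1 := by
    rw [he, norm_smul, norm_inv, Real.norm_of_nonneg (norm_nonneg _)]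
    exact inv_mul_le_one
  obtain ⟨w, hw, hwn⟩ := hcurve e he1 (fun y hy => by
    rw [he, real_inner_smul_right]
    exact mul_nonpos_of_nonneg_of_nonpos (by positivity) (hpol y hy)) t ht
  have hxe : ⟪x, e⟫ = r := by
    have h1 : ⟪x, x - p⟫ = r * r := by
      rw [hr, ← real_inner_self_eq_norm_mul_norm]
      have h2 : ⟪x - p, x - p⟫ = ⟪x, x - p⟫ - ⟪p, x - p⟫ := inner_sub_left _ _ _
      rw [real_inner_comm (x - p) p, horth] at h2
      linarith
    rw [he, real_inner_smul_right, h1]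
    rcases eq_or_ne r 0 with h0 | h0
    · simp [h0]
    · field_simp
  refine ⟨w, hw, ?_⟩
  have h1 : w - x₀ = t • e + (w - (x₀ + t • e)) := by abel
  rw [h1, inner_add_right, real_inner_smul_right, hxe]
  have h2 : -⟪x, w - (x₀ + t • e)⟫ ≤ B * (C * t ^ (1 + (α : ℝ))) :=
    ((neg_le_abs _).trans (abs_real_inner_le_norm _ _)).trans (by gcongr)
  have h3 : t * infDist x (normalCone D x₀) ≤ t * r := mul_le_mul_of_nonneg_left hdist ht.1
  linarith

end ConeReducible

/-- A segment is itself a compact convex set. -/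
theorem LocallyStronglyConvex.convexOn {Y : Type*} [NormedAddCommGroup Y]
    [InnerProductSpace ℝ Y] {l : Y → ℝ}
    (hl : LocallyStronglyConvex l) : ConvexOn ℝ univ l := by
  refine ⟨convex_univ, fun x _ y _ a b ha hb hab => ?_⟩
  obtain ⟨m, hm, hS⟩ := hl (segment ℝ x y)
    (by
      rw [segment_eq_image]
      exact isCompact_Icc.image (by fun_prop)) (convex_segment x y)
  have := hS.2 (left_mem_segment ℝ x y) (right_mem_segment ℝ x y) ha hb hab
  have h2 : 0 ≤ a * b * (m / 2 * ‖x - y‖ ^ 2) := by positivity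
  linarith

/-! ### First-order inequalities along segments -/

section Gradient

variable {Y : Type*} [NormedAddCommGroup Y] [InnerProductSpace ℝ Y] [CompleteSpace Y]

/-- A first-order upper bound along a segment bounds the directional derivative. -/
theorem inner_gradient_le_of_segment {l : Y → ℝ} {y : Y} (hl : DifferentiableAt ℝ l y) {d : Y}
    {a b : ℝ} (h : ∀ t : ℝ, 0 < t → t ≤ 1 → l (y + t • d) - l y ≤ t * (a + t * b)) :
    ⟪gradient l y, d⟫ ≤ a := by
  have hline : HasDerivAt (fun t : ℝ => l (y + t • d)) ⟪gradient l y, d⟫ 0 := by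
    have hd : HasDerivAt (fun t : ℝ => y + t • d) d 0 := by
      simpa using ((hasDerivAt_id (0 : ℝ)).smul_const d).const_add y
    have hl' : HasFDerivAt l (InnerProductSpace.toDual ℝ Y (gradient l y)) (y + (0 : ℝ) • d) := by
      simpa using hl.hasGradientAt.hasFDerivAt
    simpa [Function.comp_def] using hl'.comp_hasDerivAt (0 : ℝ) hd
  have hs := (hasDerivAt_iff_tendsto_slope_zero.1 hline).mono_left (nhdsGT_le_nhdsNE (0 : ℝ))
  have hlim : Filter.Tendsto (fun t : ℝ => a + t * b) (𝓝[>] 0) (𝓝 a) := by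
    have : Filter.Tendsto (fun t : ℝ => a + t * b) (𝓝 0) (𝓝 (a + 0 * b)) :=
      (by fun_prop : Continuous fun t : ℝ => a + t * b).tendsto 0
    rw [zero_mul, add_zero] at this
    exact this.mono_left nhdsWithin_le_nhds
  refine le_of_tendsto_of_tendsto hs hlim ?_
  filter_upwards [self_mem_nhdsWithin,
    nhdsWithin_le_nhds (eventually_lt_nhds (zero_lt_one (α := ℝ)))] with t (h1 : 0 < t) h2
  simp only [zero_add, zero_smul, add_zero, smul_eq_mul]
  rw [inv_mul_le_iff₀ h1]
  exact h t h1 h2.le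

/-- Quadratic growth of a strongly convex function above its tangent. -/
theorem add_sq_le_of_strongConvexOn {S : Set Y} {m : ℝ} {l : Y → ℝ} (hS : StrongConvexOn S m l)
    {y z : Y} (hy : y ∈ S) (hz : z ∈ S) (hl : DifferentiableAt ℝ l y) :
    l y + ⟪gradient l y, z - y⟫ + m / 2 * ‖z - y‖ ^ 2 ≤ l z := by
  -- The factor `t * (1 - t)` of the modulus splits: its linear part goes into `a`, its quadratic
  -- part into `b`.
  have := inner_gradient_le_of_segment hl (d := z - y) (a := l z - l y - m / 2 * ‖z - y‖ ^ 2)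
    (b := m / 2 * ‖z - y‖ ^ 2) fun t ht0 ht1 => by
      have h := hS.2 hy hz (sub_nonneg.2 ht1) ht0.le (by ring)
      have e : (1 - t) • y + t • z = y + t • (z - y) := by module
      rw [e, norm_sub_rev y z, smul_eq_mul, smul_eq_mul] at h
      linarith
  linarith

end Gradient

/-! ### The objective and its optimality condition -/

section Objective

variable {X Y : Type*} [NormedAddCommGroup X] [InnerProductSpace ℝ X]
  [NormedAddCommGroup Y] [InnerProductSpace ℝ Y]

theorem supportFunction_le_coe_iff {D : Set X} {x : X} {r : ℝ} :
    supportFunction D x ≤ r ↔ ∀ y ∈ D, ⟪x, y⟫ ≤ r := by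
  simp [supportFunction, iSup_le_iff]

theorem supportFunction_ne_bot {D : Set X} (hD : D.Nonempty) (x : X) :
    supportFunction D x ≠ ⊥ := by
  obtain ⟨y, hy⟩ := hD
  refine ne_bot_of_le_ne_bot (EReal.coe_ne_bot ⟪x, y⟫) ?_
  exact le_iSup₂ (f := fun y (_ : y ∈ D) => ((⟪x, y⟫ : ℝ) : EReal)) y hy

theorem supportFunction_eq_of_mem_normalCone {D : Set X} {x w : X} (hx : x ∈ normalCone D w) :
    supportFunction D x = (⟪x, w⟫ : ℝ) := by
  refine le_antisymm (supportFunction_le_coe_iff.2 fun y hy => ?_)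
    (le_iSup₂ (f := fun y (_ : y ∈ D) => ((⟪x, y⟫ : ℝ) : EReal)) w hx.1)
  have := hx.2 y hy
  rw [inner_sub_right] at this
  linarith

/-- A linear map is metrically regular onto its fibres. -/
theorem exists_infDist_fiber_le [FiniteDimensional ℝ X] (T : X →ₗ[ℝ] Y) :
    ∃ c > (0 : ℝ), ∀ x x₀ : X, infDist x (T ⁻¹' {T x₀}) ≤ c * ‖T x - T x₀‖ := by
  obtain ⟨R, hR⟩ := T.rangeRestrict.exists_rightInverse_of_surjective T.range_rangeRestrict
  obtain ⟨c, hc, hRc⟩ := (LinearMap.toContinuousLinearMap R).bound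
  simp only [LinearMap.coe_toContinuousLinearMap'] at hRc
  refine ⟨c, hc, fun x x₀ => ?_⟩
  have hTR : T (R (T.rangeRestrict (x - x₀))) = T (x - x₀) :=
    congrArg Subtype.val (LinearMap.congr_fun hR (T.rangeRestrict (x - x₀)))
  have hmem : x - R (T.rangeRestrict (x - x₀)) ∈ T ⁻¹' {T x₀} := by
    rw [mem_preimage, mem_singleton_iff, map_sub, hTR, map_sub]
    abel
  refine (infDist_le_dist_of_mem hmem).trans ?_
  rw [dist_eq_norm, sub_sub_cancel, ← map_sub]
  exact hRc _

variable {l : Y → ℝ} {T : X →ₗ[ℝ] Y} {v : X} {D : Set X}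

theorem objective_eq_coe {x : X} {q : ℝ} (hq : supportFunction D x = q) :
    objective l T v D x = ((l (T x) + ⟪v, x⟫ + q : ℝ) : EReal) := by
  rw [objective, hq, ← EReal.coe_add]

theorem objective_ne_bot (hD : D.Nonempty) (x : X) : objective l T v D x ≠ ⊥ := by
  rw [objective, Ne, EReal.add_eq_bot_iff, not_or]
  exact ⟨EReal.coe_ne_bot _, supportFunction_ne_bot hD x⟩

theorem exists_supportFunction_eq_coe (hD : D.Nonempty) {x : X}
    (hx : objective l T v D x ≠ ⊤) : ∃ q : ℝ, supportFunction D x = q := by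
  have htop : supportFunction D x ≠ ⊤ := fun h => hx (by rw [objective, h, EReal.coe_add_top])
  exact ⟨_, (EReal.coe_toReal htop (supportFunction_ne_bot hD x)).symm⟩

/-- This removes extended reals: sublevel sets and epigraph become intersections over `y ∈ D`,
whence closedness and convexity. -/
theorem objective_le_coe_iff (hD : D.Nonempty) {x : X} {r : ℝ} :
    objective l T v D x ≤ r ↔ ∀ y ∈ D, l (T x) + ⟪v, x⟫ + ⟪x, y⟫ ≤ r := by
  have : objective l T v D x ≤ r ↔ supportFunction D x ≤ ((r - (l (T x) + ⟪v, x⟫) : ℝ) : EReal) := by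
    rcases eq_or_ne (supportFunction D x) ⊤ with h | h
    · simp only [objective, h, EReal.coe_add_top, top_le_iff, EReal.coe_ne_top]
    · rw [objective]
      lift supportFunction D x to ℝ using ⟨h, supportFunction_ne_bot hD x⟩ with q
      norm_cast
      constructor <;> intro h <;> linarith
  rw [this, supportFunction_le_coe_iff]
  refine forall₂_congr fun y _ => ?_
  constructor <;> intro h <;> linarith

theorem objective_zero (hD : D.Nonempty) : objective l T v D 0 = (l 0 : ℝ) := by
  have h0 : supportFunction D (0 : X) = ((0 : ℝ) : EReal) := by
    obtain ⟨y, hy⟩ := hD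
    rw [supportFunction_eq_of_mem_normalCone (zero_mem_normalCone hy), inner_zero_left]
  rw [objective_eq_coe h0]
  simp

theorem objective_isProperClosedConvex [FiniteDimensional ℝ X] (hD : D.Nonempty)
    (hl : ConvexOn ℝ univ l) (hlc : Continuous l) :
    IsProperClosedConvex (objective l T v D) := by
  have hTc : Continuous T := T.continuous_of_finiteDimensional
  refine ⟨objective_ne_bot hD, ⟨0, ?_⟩, ?_, ?_⟩
  · rw [objective_zero hD]
    exact EReal.coe_ne_top _
  · rw [lowerSemicontinuous_iff_isClosed_preimage]
    intro r
    induction r with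
    | bot =>
      convert isClosed_empty (X := X)
      ext x
      simpa using objective_ne_bot hD x
    | top => simp
    | coe r =>
      have : objective l T v D ⁻¹' Iic (r : EReal)
          = ⋂ y ∈ D, {x | l (T x) + ⟪v, x⟫ + ⟪x, y⟫ ≤ r} := by
        ext x
        simp [objective_le_coe_iff hD]
      rw [this]
      exact isClosed_biInter fun y _ => isClosed_le (by fun_prop) continuous_const
  · rintro ⟨x, r⟩ hx ⟨y, s⟩ hy a b ha hb hab
    simp only [mem_ofPred_eq, Prod.smul_mk, Prod.mk_add_mk, objective_le_coe_iff hD] at hx hy ⊢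
    intro u hu
    have h1 := mul_le_mul_of_nonneg_left (hx u hu) ha
    have h2 := mul_le_mul_of_nonneg_left (hy u hu) hb
    have h3 := hl.2 (mem_univ (T x)) (mem_univ (T y)) ha hb hab
    simp only [map_add, map_smul, inner_add_left, inner_add_right, real_inner_smul_left,
      real_inner_smul_right, smul_eq_mul] at h3 ⊢
    linarith

variable [FiniteDimensional ℝ X] [FiniteDimensional ℝ Y] [CompleteSpace Y]

/-- Fermat's rule without subdifferential calculus: linear growth of `σ_D` at rate `a` along `u`
forces `⟪w, u⟫ ≤ a` (`hray`). A separating direction then yields `w ∈ D`, and `u = -x₀` yields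
`σ_D(x₀) ≤ ⟪w, x₀⟫`. -/
theorem mem_normalCone_of_isMin (hD : D.Nonempty) (hDconv : Convex ℝ D) (hDcl : IsClosed D)
    {x₀ : X} (hl : DifferentiableAt ℝ l (T x₀))
    (hmin : ∀ x, objective l T v D x₀ ≤ objective l T v D x) :
    x₀ ∈ normalCone D (-(LinearMap.adjoint T (gradient l (T x₀))) - v) := by
  have := FiniteDimensional.complete ℝ X
  have hfin : objective l T v D x₀ ≠ ⊤ :=
    ne_top_of_le_ne_top (by rw [objective_zero hD]; exact EReal.coe_ne_top _) (hmin 0)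
  obtain ⟨q, hq⟩ := exists_supportFunction_eq_coe hD hfin
  set w := -(LinearMap.adjoint T (gradient l (T x₀))) - v with hw
  have hwu : ∀ u, ⟪w, u⟫ = -⟪gradient l (T x₀), T u⟫ - ⟪v, u⟫ := fun u => by
    rw [hw, inner_sub_left, inner_neg_left, LinearMap.adjoint_inner_left]
  have hxq : ∀ y ∈ D, ⟪x₀, y⟫ ≤ q := supportFunction_le_coe_iff.1 hq.le
  have hray : ∀ (u : X) (a : ℝ),
      (∀ t : ℝ, 0 < t → t ≤ 1 → ∀ y ∈ D, ⟪x₀ + t • u, y⟫ ≤ q + t * a) → ⟪w, u⟫ ≤ a := by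
    intro u a h
    have key : ∀ t : ℝ, 0 < t → t ≤ 1 →
        l (T x₀) - l (T x₀ + t • T u) ≤ t * (a + ⟪v, u⟫) := by
      intro t ht0 ht1
      have h1 : objective l T v D (x₀ + t • u)
          ≤ ((l (T (x₀ + t • u)) + ⟪v, x₀ + t • u⟫ + (q + t * a) : ℝ) : EReal) :=
        (objective_le_coe_iff hD).2 fun y hy => by
          have := h t ht0 ht1 y hy
          linarith
      have h2 := (hmin _).trans h1
      rw [objective_eq_coe hq, EReal.coe_le_coe_iff, inner_add_right, real_inner_smul_right,
        map_add, map_smul] at h2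
      linarith
    have hneg := inner_gradient_le_of_segment (l := fun y => -l y) hl.neg (d := T u)
      (a := a + ⟪v, u⟫) (b := 0) fun t ht0 ht1 => by
        have := key t ht0 ht1
        linarith
    have hg : gradient (fun y => -l y) (T x₀) = -gradient l (T x₀) := by
      simp [gradient, fderiv_fun_neg]
    rw [hg, inner_neg_left] at hneg
    rw [hwu]
    linarith
  have hwD : w ∈ D := by
    by_contra hwD
    obtain ⟨f, a, hfa, haw⟩ := geometric_hahn_banach_closed_point hDconv hDcl hwD
    set u := (InnerProductSpace.toDual ℝ X).symm f with hu
    have hfu : ∀ y, ⟪u, y⟫ = f y := fun y => InnerProductSpace.toDual_symm_apply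
    have := hray u a fun t ht0 _ y hy => by
      rw [inner_add_left, real_inner_smul_left, hfu]
      have := mul_le_mul_of_nonneg_left (hfa y hy).le ht0.le
      linarith [hxq y hy]
    rw [real_inner_comm, hfu] at this
    linarith
  have hqw : q ≤ ⟪w, x₀⟫ := by
    have := hray (-x₀) (-q) fun t ht0 ht1 y hy => by
      rw [inner_add_left, real_inner_smul_left, inner_neg_left]
      have := mul_le_mul_of_nonneg_left (hxq y hy) (sub_nonneg.2 ht1)
      linarith
    rw [inner_neg_right] at this
    linarith
  refine ⟨hwD, fun y hy => ?_⟩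
  rw [inner_sub_right, real_inner_comm w x₀]
  linarith [hxq y hy]

end Objective

/-! ### Power desingularizing functions -/

section KL

/-- The power functions are desingularizing functions. -/
theorem hasKLExponentAt_of_forall {E : Type*} [NormedAddCommGroup E] [InnerProductSpace ℝ E]
    {h : E → EReal} {x₀ : E} {θ : ℝ} (hθ0 : 0 ≤ θ) (hθ1 : θ < 1) (hh : IsProperClosedConvex h)
    (hmin : ∀ x, h x₀ ≤ h x) {C : ℝ} (hC : 0 < C) {U : Set E} (hU : U ∈ 𝓝 x₀)
    (hKL : ∀ x ∈ U, h x₀ < h x → h x < h x₀ + 1 → 0 < (h x - h x₀).toReal ∧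
      ∀ ξ ∈ subdifferential h x, (h x - h x₀).toReal ^ θ ≤ C * ‖ξ‖) :
    HasKLExponentAt h x₀ θ := by
  have hp0 : 0 < 1 - θ := by linarith
  have hIco : {s : ℝ | 0 ≤ s ∧ (s : EReal) < 1} = Ico 0 1 := by
    ext s
    simp only [mem_ofPred_eq, mem_Ico]
    norm_cast
  have hIoo : {s : ℝ | 0 < s ∧ (s : EReal) < 1} = Ioo 0 1 := by
    ext s
    simp only [mem_ofPred_eq, mem_Ioo]
    norm_cast
  have ha : 0 < C / (1 - θ) := by positivity
  have hderiv : ∀ s : ℝ, 0 < s → deriv (fun s : ℝ => C / (1 - θ) * s ^ (1 - θ)) s = C * s ^ (-θ) := by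
    intro s hs
    rw [((Real.hasDerivAt_rpow_const (p := 1 - θ) (Or.inl hs.ne')).const_mul _).deriv,
      sub_sub_cancel_left]
    field_simp
  -- The factor `C / (1 - θ)` makes the derivative `C * s ^ (-θ)`; `0` is a subgradient at the
  -- minimizer.
  refine ⟨hθ0, hθ1, 1, C / (1 - θ), ha, hh, ⟨0, ?_⟩, zero_lt_one, ?_, ?_, ?_, ?_, ?_, ?_, U, hU, ?_⟩
  · intro y
    simpa using hmin y
  · exact ((Real.continuous_rpow_const hp0.le).const_mul _).continuousOn
  · rw [hIco]
    exact ((Real.concaveOn_rpow hp0.le (by linarith)).subset Ico_subset_Ici_self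
      (convex_Ico 0 1)).smul ha.le
  · intro s hs _
    positivity
  · simp [Real.zero_rpow hp0.ne']
  · rw [hIoo]
    exact fun s hs => (contDiffAt_const.mul
      (Real.contDiffAt_rpow_const_of_ne hs.1.ne')).contDiffWithinAt
  · intro s hs _
    rw [hderiv s hs]
    positivity
  · intro x hx h1 h2
    obtain ⟨hs, hξs⟩ := hKL x hx h1 h2
    set s := (h x - h x₀).toReal
    rw [hderiv s hs]
    have hpos : 0 < C * s ^ (-θ) := by positivity
    have hle : ENNReal.ofReal ((C * s ^ (-θ))⁻¹) ≤ infEDist 0 (subdifferential h x) := by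
      refine le_infEDist.2 fun ξ hξ => ?_
      rw [edist_dist, dist_zero_left]
      refine ENNReal.ofReal_le_ofReal ?_
      rw [Real.rpow_neg hs.le, mul_inv, inv_inv, inv_mul_le_iff₀ hC]
      exact hξs ξ hξ
    calc (1 : ℝ≥0∞) = ENNReal.ofReal (C * s ^ (-θ)) * ENNReal.ofReal ((C * s ^ (-θ))⁻¹) := by
          rw [← ENNReal.ofReal_mul hpos.le, mul_inv_cancel₀ hpos.ne', ENNReal.ofReal_one]
      _ ≤ _ := by gcongr

end KL

/-! ### Error bound and KL exponent -/

section ErrorBound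

variable {X Y : Type*} [NormedAddCommGroup X] [InnerProductSpace ℝ X] [FiniteDimensional ℝ X]
  [NormedAddCommGroup Y] [InnerProductSpace ℝ Y]

/-- If `s ∈ (0, 1]` dominates `t * r - C * t ^ (1 + α)` for all small `t`, then `r` is at most of
order `s ^ (α / (1 + α))`. -/
theorem le_mul_rpow_of_forall_mul_sub_le {α t₀ C r s : ℝ} (hα : 0 < α) (ht₀ : 0 < t₀)
    (hs0 : 0 < s) (hs1 : s ≤ 1) (h : ∀ t ∈ Icc 0 t₀, t * r - C * t ^ (1 + α) ≤ s) :
    r ≤ (1 + C * t₀ ^ (1 + α)) / t₀ * s ^ (1 - 1 / (α + 1)) := by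
  have hP : 0 < s ^ (1 / (α + 1)) := Real.rpow_pos_of_pos hs0 _
  have hP1 : s ^ (1 / (α + 1)) ≤ 1 := Real.rpow_le_one hs0.le hs1 (by positivity)
  -- This `t` makes `t ^ (1 + α)` proportional to `s`; `s ≤ 1` keeps it within `[0, t₀]`.
  have h1 := h (t₀ * s ^ (1 / (α + 1))) ⟨by positivity, mul_le_of_le_one_right ht₀.le hP1⟩
  have h2 : (t₀ * s ^ (1 / (α + 1))) ^ (1 + α) = t₀ ^ (1 + α) * s := by
    rw [Real.mul_rpow ht₀.le hP.le, ← Real.rpow_mul hs0.le]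
    have : 1 / (α + 1) * (1 + α) = 1 := by
      have : α + 1 ≠ 0 := by positivity
      field_simp
      ring
    rw [this, Real.rpow_one]
  have h3 : s = s ^ (1 / (α + 1)) * s ^ (1 - 1 / (α + 1)) := by
    rw [← Real.rpow_add hs0, add_sub_cancel, Real.rpow_one]
  rw [h2] at h1
  have h4 : s ^ (1 / (α + 1)) * (t₀ * r)
      ≤ s ^ (1 / (α + 1)) * ((1 + C * t₀ ^ (1 + α)) * s ^ (1 - 1 / (α + 1))) := by
    calc s ^ (1 / (α + 1)) * (t₀ * r) ≤ (1 + C * t₀ ^ (1 + α)) * s := by linarith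
      _ = (1 + C * t₀ ^ (1 + α)) * (s ^ (1 / (α + 1)) * s ^ (1 - 1 / (α + 1))) := by rw [← h3]
      _ = _ := by ring
  have h5 := le_of_mul_le_mul_left h4 hP
  rw [div_mul_eq_mul_div, le_div_iff₀ ht₀]
  linarith

/-- For `s ≤ 1`, quadratic growth gives the exponent `1/2`, which may be weakened to any smaller
`p`, such as `α / (α + 1)`. -/
theorem le_mul_rpow_of_mul_sq_le {p m τ s : ℝ} (hp : p ≤ 1 / 2) (hm : 0 < m)
    (hs0 : 0 < s) (hs1 : s ≤ 1) (h : m / 2 * τ ^ 2 ≤ s) : τ ≤ √(2 / m) * s ^ p := by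
  refine (le_abs_self τ).trans (abs_le_of_sq_le_sq ?_ (by positivity))
  rw [mul_pow, Real.sq_sqrt (by positivity), ← Real.rpow_natCast (s ^ p),
    ← Real.rpow_mul hs0.le]
  have h1 : s ≤ s ^ (p * (2 : ℕ)) := by
    nth_rw 1 [← Real.rpow_one s]
    refine Real.rpow_le_rpow_of_exponent_ge hs0 hs1 ?_
    push_cast
    linarith
  calc τ ^ 2 = 2 / m * (m / 2 * τ ^ 2) := by field_simp
    _ ≤ 2 / m * s ^ (p * (2 : ℕ)) := by gcongr; exact h.trans h1

variable [FiniteDimensional ℝ Y] [CompleteSpace Y]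
  {l : Y → ℝ} {T : X →ₗ[ℝ] Y} {v : X} {D : Set X}

/-- The value of the objective above its minimum, split into the Bregman distance of `l` and the
gap of the support function. -/
theorem objective_gap_eq {x₀ w : X} (hw : w = -(LinearMap.adjoint T (gradient l (T x₀))) - v)
    (x : X) (q : ℝ) :
    l (T x) + ⟪v, x⟫ + q - (l (T x₀) + ⟪v, x₀⟫ + ⟪x₀, w⟫)
      = (l (T x) - l (T x₀) - ⟪gradient l (T x₀), T x - T x₀⟫) + (q - ⟪x, w⟫) := by
  have h1 : ⟪x - x₀, w⟫ = -⟪gradient l (T x₀), T x - T x₀⟫ - ⟪v, x - x₀⟫ := by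
    rw [real_inner_comm, hw, inner_sub_left, inner_neg_left, LinearMap.adjoint_inner_left, map_sub]
  rw [inner_sub_left, inner_sub_right v] at h1
  linarith

/-- Growth of the objective near a minimizer. -/
theorem exists_infDist_le_objective_rpow {α : ℝ≥0} (hα0 : 0 < α) (hα1 : α ≤ 1)
    (hDconv : Convex ℝ D) (hl : LocallyStronglyConvex l) (hdiff : Differentiable ℝ l) {x₀ w : X}
    (hw : w = -(LinearMap.adjoint T (gradient l (T x₀))) - v) (hred : IsConeReducibleAt α D w)
    (hx₀ : x₀ ∈ normalCone D w)
    (hreg : BoundedlyLinearlyRegularAt (T ⁻¹' {T x₀}) (normalCone D w) x₀) :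
    ∃ C > (0 : ℝ), ∀ x ∈ closedBall x₀ 1, ∀ q : ℝ, supportFunction D x = q → ∀ s : ℝ,
      s = l (T x) + ⟪v, x⟫ + q - (l (T x₀) + ⟪v, x₀⟫ + ⟪x₀, w⟫) → 0 < s → s ≤ 1 →
      infDist x (T ⁻¹' {T x₀} ∩ normalCone D w) ≤ C * s ^ (1 - 1 / ((α : ℝ) + 1)) := by
  have hαpos : (0 : ℝ) < α := hα0
  have hαle : (α : ℝ) ≤ 1 := hα1
  obtain ⟨c₁, hc₁, hfib⟩ := exists_infDist_fiber_le T
  obtain ⟨c₂, hc₂, hBLR⟩ := hreg.2 (closedBall x₀ 1) (closedBall_mem_nhds _ one_pos)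
    isBounded_closedBall
  obtain ⟨t₀, ht₀, C₁, hC₁, hgrow⟩ := hred.exists_inner_ge hDconv hx₀.1 (‖x₀‖ + 1) (by positivity)
  obtain ⟨m, hm, hS⟩ := hl (T '' closedBall x₀ 1)
    ((isCompact_closedBall x₀ 1).image T.continuous_of_finiteDimensional)
    ((convex_closedBall x₀ 1).linear_image T)
  refine ⟨c₂ * (c₁ * √(2 / m) + (1 + C₁ * t₀ ^ (1 + (α : ℝ))) / t₀), by positivity,
    fun x hx q hq s hs hs0 hs1 => ?_⟩
  rw [objective_gap_eq hw] at hs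
  have hstrong := add_sq_le_of_strongConvexOn hS (mem_image_of_mem T (mem_closedBall_self zero_le_one))
    (mem_image_of_mem T hx) (hdiff (T x₀))
  have hxq : ∀ y ∈ D, ⟪x, y⟫ ≤ q := supportFunction_le_coe_iff.1 hq.le
  have hgap := hxq w hx₀.1
  have hτ : ‖T x - T x₀‖ ≤ √(2 / m) * s ^ (1 - 1 / ((α : ℝ) + 1)) := by
    refine le_mul_rpow_of_mul_sq_le ?_ hm hs0 hs1 (by linarith)
    have : 1 / 2 ≤ 1 / ((α : ℝ) + 1) := one_div_le_one_div_of_le (by positivity) (by linarith)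
    linarith
  have hr : infDist x (normalCone D w)
      ≤ (1 + C₁ * t₀ ^ (1 + (α : ℝ))) / t₀ * s ^ (1 - 1 / ((α : ℝ) + 1)) := by
    refine le_mul_rpow_of_forall_mul_sub_le hαpos ht₀ hs0 hs1 fun t ht => ?_
    have hxB : ‖x‖ ≤ ‖x₀‖ + 1 := by
      have := norm_le_norm_add_norm_sub' x x₀
      rw [mem_closedBall, dist_eq_norm] at hx
      linarith
    obtain ⟨y, hy, hyt⟩ := hgrow x hxB t ht
    rw [inner_sub_right] at hyt
    -- The Bregman part is nonnegative, so the support gap alone is at most `s`.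
    have h0 : 0 ≤ m / 2 * ‖T x - T x₀‖ ^ 2 := by positivity
    linarith [hxq y hy]
  calc infDist x (T ⁻¹' {T x₀} ∩ normalCone D w)
      ≤ c₂ * (infDist x (T ⁻¹' {T x₀}) + infDist x (normalCone D w)) := hBLR x hx
    _ ≤ c₂ * (c₁ * (√(2 / m) * s ^ (1 - 1 / ((α : ℝ) + 1)))
        + (1 + C₁ * t₀ ^ (1 + (α : ℝ))) / t₀ * s ^ (1 - 1 / ((α : ℝ) + 1))) := by
      gcongr
      exact (hfib x x₀).trans (by gcongr)
    _ = _ := by ring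

/-- Both parts of the gap vanish on the fibre intersected with the normal cone, so `s ≤ ‖ξ‖ * dist`
to that set. Inserting the error bound and cancelling `s ^ (α / (α + 1))` leaves the KL inequality.
-/
theorem objective_hasKLExponentAt {α : ℝ≥0} (hα0 : 0 < α) (hα1 : α ≤ 1)
    (hDconv : Convex ℝ D) (hl : LocallyStronglyConvex l) (hdiff : Differentiable ℝ l) {x₀ w : X}
    (hmin : ∀ x, objective l T v D x₀ ≤ objective l T v D x)
    (hw : w = -(LinearMap.adjoint T (gradient l (T x₀))) - v) (hred : IsConeReducibleAt α D w)
    (hx₀ : x₀ ∈ normalCone D w)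
    (hreg : BoundedlyLinearlyRegularAt (T ⁻¹' {T x₀}) (normalCone D w) x₀) :
    HasKLExponentAt (objective l T v D) x₀ (1 / ((α : ℝ) + 1)) := by
  have hD : D.Nonempty := ⟨w, hx₀.1⟩
  have hαpos : (0 : ℝ) < α := hα0
  obtain ⟨C, hC, hbound⟩ := exists_infDist_le_objective_rpow hα0 hα1 hDconv hl hdiff hw hred hx₀ hreg
  set b := l (T x₀) + ⟪v, x₀⟫ + ⟪x₀, w⟫ with hb
  have hobj₀ : objective l T v D x₀ = (b : ℝ) :=
    objective_eq_coe (supportFunction_eq_of_mem_normalCone hx₀)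
  refine hasKLExponentAt_of_forall (C := C) (by positivity)
    ((div_lt_one (by positivity)).2 (by linarith))
    (objective_isProperClosedConvex hD hl.convexOn hdiff.continuous) hmin hC
    (closedBall_mem_nhds x₀ one_pos) fun x hx h1 h2 => ?_
  obtain ⟨q, hq⟩ := exists_supportFunction_eq_coe hD (ne_top_of_lt h2)
  have hobj : objective l T v D x = ((l (T x) + ⟪v, x⟫ + q : ℝ) : EReal) := objective_eq_coe hq
  rw [hobj, hobj₀] at h1 h2 ⊢
  rw [← EReal.coe_sub, EReal.toReal_coe]
  norm_cast at h1 h2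
  set s := l (T x) + ⟪v, x⟫ + q - b with hs
  have hs0 : 0 < s := by linarith
  refine ⟨hs0, fun ξ hξ => ?_⟩
  have hdist := hbound x hx q hq s hs hs0 (by linarith)
  have hle : s ≤ ‖ξ‖ * infDist x (T ⁻¹' {T x₀} ∩ normalCone D w) := by
    have hmul : ∀ y ∈ T ⁻¹' {T x₀} ∩ normalCone D w, s ≤ ‖ξ‖ * dist x y := by
      rintro y ⟨hyT, hyN⟩
      have hyT : T y = T x₀ := hyT
      have hval := objective_gap_eq hw y ⟪y, w⟫
      have h3 := hξ y
      rw [hobj, objective_eq_coe (supportFunction_eq_of_mem_normalCone hyN), ← EReal.coe_add,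
        EReal.coe_le_coe_iff] at h3
      rw [hyT, sub_self, sub_self, inner_zero_right] at hval
      rw [hyT] at h3
      have h4 : -⟪ξ, y - x⟫ ≤ ‖ξ‖ * dist x y := by
        rw [dist_comm, dist_eq_norm]
        exact (neg_le_abs _).trans (abs_real_inner_le_norm _ _)
      linarith
    -- Positivity of `‖ξ‖` permits division before passing to the infimum over `y`.
    have hξ0 : 0 < ‖ξ‖ := by
      by_contra h0
      have := hmul x₀ hreg.1
      rw [le_antisymm (not_lt.1 h0) (norm_nonneg _), zero_mul] at this
      linarith
    rw [mul_comm, ← div_le_iff₀ hξ0]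
    refine (le_infDist ⟨x₀, hreg.1⟩).2 fun {y} hy => ?_
    rw [div_le_iff₀ hξ0, mul_comm]
    exact hmul y hy
  have hP : 0 < s ^ (1 - 1 / ((α : ℝ) + 1)) := Real.rpow_pos_of_pos hs0 _
  have h3 : s = s ^ (1 / ((α : ℝ) + 1)) * s ^ (1 - 1 / ((α : ℝ) + 1)) := by
    rw [← Real.rpow_add hs0, add_sub_cancel, Real.rpow_one]
  refine le_of_mul_le_mul_right ?_ hP
  rw [← h3]
  calc s ≤ ‖ξ‖ * infDist x (T ⁻¹' {T x₀} ∩ normalCone D w) := hle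
    _ ≤ ‖ξ‖ * (C * s ^ (1 - 1 / ((α : ℝ) + 1))) := by gcongr
    _ = _ := by ring

end ErrorBound

end ConvexKL

theorem theorem4p3 {X Y : Type*}
    [NormedAddCommGroup X] [InnerProductSpace ℝ X] [FiniteDimensional ℝ X]
    [NormedAddCommGroup Y] [InnerProductSpace ℝ Y] [FiniteDimensional ℝ Y] [CompleteSpace Y]
    (α : ℝ≥0) (hα0 : 0 < α) (hα1 : α ≤ 1)
    (D : Set X) (hDne : D.Nonempty) (hDconv : Convex ℝ D) (hDred : ConvexKL.IsConeReducible α D)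
    (T : X →ₗ[ℝ] Y) (l : Y → ℝ)
    (hl_conv : ConvexKL.LocallyStronglyConvex l)
    (hl_diff : Differentiable ℝ l) (hl_grad : LocallyLipschitz (gradient l))
    (v : X)
    (xbar : X) (hxbar : ∀ x, ConvexKL.objective l T v D xbar ≤ ConvexKL.objective l T v D x)
    (wbar : X) (hwbar : wbar = -(LinearMap.adjoint T (gradient l (T xbar))) - v) :
    xbar ∈ ConvexKL.normalCone D wbar ∧
    (∃ ρ δ κ : ℝ, 0 < ρ ∧ 0 < δ ∧ 0 < κ ∧ ∀ w ∈ closedBall wbar ρ,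
      ConvexKL.normalCone D w ∩ closedBall xbar δ ⊆
        ConvexKL.normalCone D wbar + (κ * ‖w - wbar‖ ^ (α : ℝ)) • closedBall (0 : X) 1) ∧
    (ConvexKL.BoundedlyLinearlyRegularAt (T ⁻¹' {T xbar}) (ConvexKL.normalCone D wbar) xbar →
      ConvexKL.HasKLExponentAt (ConvexKL.objective l T v D) xbar (1 / ((α : ℝ) + 1))) := by
  have hN : xbar ∈ ConvexKL.normalCone D wbar :=
    hwbar ▸ ConvexKL.mem_normalCone_of_isMin hDne hDconv hDred.1 (hl_diff _) hxbar
  have hred := hDred.2 wbar hN.1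
  refine ⟨hN, ?_, fun hreg => ConvexKL.objective_hasKLExponentAt hα0 hα1 hDconv hl_conv hl_diff
    hxbar hwbar hred hN hreg⟩
  -- The norm bound `‖xbar‖ + 1` corresponds to the choice `δ = 1`.
  obtain ⟨ρ, hρ, κ, hκ, h⟩ := hred.exists_normalCone_near hDconv hN.1 (‖xbar‖ + 1) (by positivity)
  refine ⟨ρ, 1, κ, hρ, one_pos, hκ, fun w hw x hx => ?_⟩
  have hxB : ‖x‖ ≤ ‖xbar‖ + 1 := by
    have h1 := norm_le_norm_add_norm_sub' x xbar
    have h2 : ‖x - xbar‖ ≤ 1 := by simpa [dist_eq_norm] using hx.2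
    linarith
  obtain ⟨x', hx', hxx'⟩ := h w hw x hx.1 hxB
  refine Set.mem_add.2 ⟨x', hx', x - x', ?_, by abel⟩
  rw [_root_.smul_closedBall _ _ zero_le_one, smul_zero, mem_closedBall_zero_iff, mul_one,
    Real.norm_of_nonneg (by positivity)]
  exact hxx'
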